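/- Let $w:[0,1]\to[0,\infty)$ be a weight function, i.e. a nonnegative measurable function that is not almost everywhere zero and for which $\int_0^1 t\,w(t)\,dt<\infty$. Put $W(x,y)=w(\max\{|x|,|y|\})$ for $(x,y)\in[-1,1]^2$, and let $L^2(W;[-1,1]^2)$ be the real $L^2$ space with inner product $\langle f,g\rangle_W=\int_{-1}^1\int_{-1}^1 f(x,y)g(x,y)W(x,y)\,dx\,dy$. Let $\mathcal B$ be the boundary of $[-1,1]^2$, let $$\int_{\mathcal B} f\,d\sigma=\int_{-1}^1[f(\xi,1)+f(\xi,-1)]\,d\xi+\int_{-1}^1[f(1,\eta)+f(-1,\eta)]\,d\eta ,\qquad \langle p,q\rangle=\int_{\mathcal B}p\,q\,d\sigma ,$$ and let $\mathcal{BV}_m$ be the space of orthogonal polynomials of degree $m$ with respect to $\langle\cdot,\cdot\rangle$ in $\mathbb R[x,y]/\langle(1-x^2)(1-y^2)\rangle$, that is, the set of classes of those polynomials of degree at most $m$ that are orthogonal to all polynomials of degree less than $m$. For each $m\ge 0$ let $Y_{m,i}$, $1\le i\le\min\{m+1,4\}$, be an orthogonal basis of $\mathcal{BV}_m$. For $k,m\ge0$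 let $P_{k,2m}$ be an orthogonal polynomial of degree $k$ with respect to the weight $t^{2m+1}w(t)$ on $[0,1]$, with $P_{0,2m}=1$. With $s=\max\{|x|,|y|\}$ and $(x,y)=s(\xi,\eta)$, $(\xi,\eta)\in\mathcal B$, define for $0\le k\le n$ and $1\le i\le\min\{n-k+1,4\}$ $$Q^n_{k,i}(x,y)=P_{k,2n-2k}(s)\,s^{n-k}\,Y_{n-k,i}(\xi,\eta)=P_{k,2n-2k}(s)\,s^{n-k}\,Y_{n-k,i}\!\left(\frac xs,\frac ys\right).$$ **Theorem.** The system $\{Q^n_{k,i}: 1\le i\le\min\{n-k+1,4\},\ 0\le k\le n,\ n\ge0\}$ is a complete orthogonal basis of $L^2(W;[-1,1]^2)$: its members are nonzero elements of this space, any two different ones (with different $(n,k,i)$) are orthogonal, and their linear span is dense. -/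

import Mathlib

open MeasureTheory

noncomputable section

/-! ### The boundary of the square -/

/-- The (unweighted) integral over the boundary `ℬ` of the square `[-1,1]²`. -/
def boundaryIntegral (f : ℝ → ℝ → ℝ) : ℝ :=
  (∫ ξ in (-1 : ℝ)..1, (f ξ 1 + f ξ (-1))) + ∫ η in (-1 : ℝ)..1, (f 1 η + f (-1) η)

/-- The bilinear form `⟨p, q⟩ = ∫_ℬ p q dσ` on polynomials in two variables. -/
def boundaryForm (p q : MvPolynomial (Fin 2) ℝ) : ℝ :=
  boundaryIntegral fun ξ η => MvPolynomial.eval ![ξ, η] p * MvPolynomial.eval ![ξ, η] q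

/-- The ideal generated by `(1 - x²)(1 - y²)`. -/
def boundaryIdeal : Ideal (MvPolynomial (Fin 2) ℝ) :=
  Ideal.span {(1 - MvPolynomial.X 0 ^ 2) * (1 - MvPolynomial.X 1 ^ 2)}

/-- Reduction modulo the ideal, as a linear map. -/
def modBoundary :
    MvPolynomial (Fin 2) ℝ →ₗ[ℝ] MvPolynomial (Fin 2) ℝ ⧸ boundaryIdeal :=
  (Ideal.Quotient.mkₐ ℝ boundaryIdeal).toLinearMap

/-- `p` is an orthogonal polynomial of degree `n` on `ℬ`: it has degree at most `n` and is
orthogonal to every polynomial of degree less than `n`. -/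
def IsBoundaryOrthogonal (n : ℕ) (p : MvPolynomial (Fin 2) ℝ) : Prop :=
  p.totalDegree ≤ n ∧
    ∀ q : MvPolynomial (Fin 2) ℝ, q.totalDegree < n → boundaryForm p q = 0

/-- The space of orthogonal polynomials of degree `n` on `ℬ`, a subspace of
`ℝ[x,y] / ⟨(1 - x²)(1 - y²)⟩`. (The orthogonal polynomials of degree `n` are closed under linear
combinations, so the span is just the set of their classes.) -/
def boundaryBV (n : ℕ) : Submodule ℝ (MvPolynomial (Fin 2) ℝ ⧸ boundaryIdeal) :=
  Submodule.span ℝ (modBoundary '' {p | IsBoundaryOrthogonal n p})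

/-- The (classes of the) polynomials `Y i` are an orthogonal basis of the space of orthogonal
polynomials of degree `n` on `ℬ`. -/
structure IsBoundaryOrthogonalBasis (n : ℕ) {ι : Type*} (Y : ι → MvPolynomial (Fin 2) ℝ) :
    Prop where
  orthogonal : ∀ i j, i ≠ j → boundaryForm (Y i) (Y j) = 0
  linearIndependent : LinearIndependent ℝ fun i => modBoundary (Y i)
  span_eq : Submodule.span ℝ (Set.range fun i => modBoundary (Y i)) = boundaryBV n

/-! ### One variable -/

/-- `w` is a weight function on `[0,1]`: nonnegative, not almost everywhere zero there, and such
that `∫₀¹ t w(t) dt` is finite (equivalently, `w(max {|x|,|y|})` is integrable on the square). -/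
structure IsRadialWeight (w : ℝ → ℝ) : Prop where
  nonneg : ∀ t ∈ Set.Icc (0 : ℝ) 1, 0 ≤ w t
  integrable : IntegrableOn (fun t => t * w t) (Set.Icc (0 : ℝ) 1)
  not_ae_zero : ¬ ∀ᵐ t ∂(volume.restrict (Set.Icc (0 : ℝ) 1)), w t = 0

/-- `p` is an orthogonal polynomial of degree `k` with respect to the weight `v` on `[0,1]`. -/
def IsOrthogonalPolynomial (v : ℝ → ℝ) (k : ℕ) (p : Polynomial ℝ) : Prop :=
  p.degree = k ∧
    ∀ q : Polynomial ℝ, q.degree < k → ∫ t in (0 : ℝ)..1, p.eval t * q.eval t * v t = 0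

/-! ### The square -/

/-- The measure `W(x,y) dx dy` on `[-1,1]²`, where `W(x,y) = w(max {|x|,|y|})`. -/
def squareMeasure (w : ℝ → ℝ) : Measure (ℝ × ℝ) :=
  (volume.restrict (Set.Icc (-1 : ℝ) 1 ×ˢ Set.Icc (-1 : ℝ) 1)).withDensity
    fun z => ENNReal.ofReal (w (max |z.1| |z.2|))

/-- The index set `n ≥ 0`, `0 ≤ k ≤ n`, `1 ≤ i ≤ min {n - k + 1, 4}`, with `i` shifted to
start from `0`. -/
abbrev SquareIndex : Type :=
  Σ n : ℕ, Σ k : Fin (n + 1), Fin (min (n - (k : ℕ) + 1) 4)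

/-- The function `(x,y) ↦ P_{k,2n-2k}(s) s^{n-k} Y_{n-k,i}(x/s, y/s)` with `s = max {|x|,|y|}`.
Here `P k m` stands for the polynomial `P_{k,2m}`. -/
def squareQ (P : ℕ → ℕ → Polynomial ℝ)
    (Y : (m : ℕ) → Fin (min (m + 1) 4) → MvPolynomial (Fin 2) ℝ) :
    SquareIndex → ℝ × ℝ → ℝ :=
  fun ⟨n, k, i⟩ z =>
    (P k (n - k)).eval (max |z.1| |z.2|) * (max |z.1| |z.2|) ^ (n - (k : ℕ)) *
      MvPolynomial.eval ![z.1 / max |z.1| |z.2|, z.2 / max |z.1| |z.2|] (Y (n - k) i)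

/-- A complete orthogonal basis of a real inner product space: nonzero, pairwise orthogonal
vectors whose linear span is dense. -/
structure IsCompleteOrthogonalBasis {E : Type*} [NormedAddCommGroup E] [InnerProductSpace ℝ E]
    {ι : Type*} (v : ι → E) : Prop where
  ne_zero : ∀ i, v i ≠ 0
  orthogonal : ∀ i j, i ≠ j → inner ℝ (v i) (v j) = 0
  complete : (Submodule.span ℝ (Set.range v)).topologicalClosure = ⊤

end

/-! Write a point of the square as s(ξ,η) with s = max(|x|,|y|) and (ξ,η) on the boundary. On each
edge of the boundary the Jacobian is s, so W dx dy is the image of the product of s w(s) ds and arc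
length (`IsRadialWeight.squareMeasure_eq_map`). Hence the inner product of g(s)p(ξ,η) and h(s)q(ξ,η)
is a radial integral times `boundaryForm p q` (`IsRadialWeight.inner_polarLp`). Each Q is such a
product, with m = n - k, g = P_{k,2m} s^m and p = Y_{m,i}.

Orthogonality: for distinct m the boundary factor vanishes; for equal m and distinct k the radial
factor vanishes, because s^m · s^m · s w = s^(2m+1) w is the weight of P_{k,2m}; otherwise only i
differs and the basis of degree m is orthogonal. No member is zero, because a nonzero g has nonzero
radial norm and `boundaryForm` is definite modulo the ideal
(`mem_boundaryIdeal_of_boundaryForm_self`).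

Completeness: a monomial of degree d equals s^d times its restriction to the boundary, and that
restriction is a combination of Y_{m,i} with m ≤ d. Then s^d Y_{m,i} = s^(d-m) · s^m Y_{m,i}, and
s^(d-m) is a combination of the P_{k,2m}, since these have every degree once. So all polynomials lie
in the span, and they are dense in L² by Stone–Weierstrass. -/

noncomputable section

open scoped ENNReal

/-! ### Arc length on the boundary of the square -/

/-- The arc length measure on the boundary of the square `[-1,1]²`. -/
def boundaryMeasure : Measure (ℝ × ℝ) :=
  (((volume.restrict (Set.Ioc (-1 : ℝ) 1)).map fun t => (t, (1 : ℝ))) +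
    (volume.restrict (Set.Ioc (-1 : ℝ) 1)).map fun t => (t, (-1 : ℝ))) +
  (((volume.restrict (Set.Ioc (-1 : ℝ) 1)).map fun t => ((1 : ℝ), t)) +
    (volume.restrict (Set.Ioc (-1 : ℝ) 1)).map fun t => ((-1 : ℝ), t))

instance : IsFiniteMeasure boundaryMeasure := by
  unfold boundaryMeasure; infer_instance

theorem lintegral_boundaryMeasure {F : ℝ × ℝ → ℝ≥0∞} (hF : Measurable F) :
    ∫⁻ p, F p ∂boundaryMeasure =
      ((∫⁻ t in Set.Ioc (-1 : ℝ) 1, F (t, 1)) + ∫⁻ t in Set.Ioc (-1 : ℝ) 1, F (t, -1)) +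
      ((∫⁻ t in Set.Ioc (-1 : ℝ) 1, F (1, t)) + ∫⁻ t in Set.Ioc (-1 : ℝ) 1, F (-1, t)) := by
  unfold boundaryMeasure
  simp only [lintegral_add_measure]
  rw [lintegral_map hF (by fun_prop), lintegral_map hF (by fun_prop),
    lintegral_map hF (by fun_prop), lintegral_map hF (by fun_prop)]

theorem ae_boundaryMeasure {p : ℝ × ℝ → Prop} (hp : MeasurableSet {z | p z})
    (h1 : ∀ t, |t| ≤ 1 → p (t, 1)) (h2 : ∀ t, |t| ≤ 1 → p (t, -1))
    (h3 : ∀ t, |t| ≤ 1 → p (1, t)) (h4 : ∀ t, |t| ≤ 1 → p (-1, t)) :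
    ∀ᵐ z ∂boundaryMeasure, p z := by
  have hm : ∀ t ∈ Set.Ioc (-1 : ℝ) 1, |t| ≤ 1 := fun t ht => abs_le.2 ⟨ht.1.le, ht.2⟩
  have key : ∀ g : ℝ → ℝ × ℝ, Measurable g → (∀ t, |t| ≤ 1 → p (g t)) →
      ∀ᵐ z ∂((volume.restrict (Set.Ioc (-1 : ℝ) 1)).map g), p z := by
    intro g hg h
    rw [ae_map_iff hg.aemeasurable hp]
    filter_upwards [ae_restrict_mem measurableSet_Ioc] with t ht using h t (hm t ht)
  unfold boundaryMeasure
  simp only [ae_add_measure_iff]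
  exact ⟨⟨key _ (by fun_prop) h1, key _ (by fun_prop) h2⟩,
    key _ (by fun_prop) h3, key _ (by fun_prop) h4⟩

theorem ae_boundaryMeasure_max_abs : ∀ᵐ z ∂boundaryMeasure, max |z.1| |z.2| = 1 := by
  refine ae_boundaryMeasure (measurableSet_eq_fun (by fun_prop) (by fun_prop)) ?_ ?_ ?_ ?_ <;>
  · intro t ht
    simp [ht]

theorem integrable_boundaryMeasure {f : ℝ × ℝ → ℝ} (hf : Continuous f) :
    Integrable f boundaryMeasure := by
  obtain ⟨C, hC⟩ := ((isCompact_Icc (a := (-1 : ℝ)) (b := 1)).prod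
    (isCompact_Icc (a := (-1 : ℝ)) (b := 1))).exists_bound_of_continuousOn hf.continuousOn
  refine Integrable.of_bound hf.aestronglyMeasurable C ?_
  filter_upwards [ae_boundaryMeasure_max_abs] with z hz
  exact hC z ⟨abs_le.1 (hz ▸ le_max_left _ _), abs_le.1 (hz ▸ le_max_right _ _)⟩

theorem integral_boundaryMeasure {f : ℝ × ℝ → ℝ} (hf : Continuous f) :
    ∫ p, f p ∂boundaryMeasure = boundaryIntegral fun ξ η => f (ξ, η) := by
  have hi := integrable_boundaryMeasure hf
  unfold boundaryMeasure at hi ⊢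
  have hab := hi.left_of_add_measure
  have hcd := hi.right_of_add_measure
  rw [integral_add_measure hab hcd,
    integral_add_measure hab.left_of_add_measure hab.right_of_add_measure,
    integral_add_measure hcd.left_of_add_measure hcd.right_of_add_measure]
  rw [integral_map (by fun_prop) hf.aestronglyMeasurable,
    integral_map (by fun_prop) hf.aestronglyMeasurable,
    integral_map (by fun_prop) hf.aestronglyMeasurable,
    integral_map (by fun_prop) hf.aestronglyMeasurable]
  unfold boundaryIntegral
  rw [intervalIntegral.integral_add, intervalIntegral.integral_add]
  · simp only [intervalIntegral.integral_of_le (show (-1 : ℝ) ≤ 1 by norm_num)]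
  all_goals exact Continuous.intervalIntegrable (by fun_prop) _ _

/-! ### Polar integration over the square -/

theorem lintegral_comp_mul_left_of_pos {G : ℝ → ℝ≥0∞} (hG : Measurable G) {a : ℝ} (ha : 0 < a) :
    ∫⁻ y, G y = ENNReal.ofReal a * ∫⁻ t, G (a * t) := by
  conv_lhs => rw [← Real.smul_map_volume_mul_left ha.ne']
  rw [lintegral_smul_measure, lintegral_map hG (by fun_prop), abs_of_pos ha, smul_eq_mul]

/-- The cone `|y| ≤ |x|` in the square. -/
def horizontalCone : Set (ℝ × ℝ) := {z | |z.2| ≤ |z.1|} ∩ {z | |z.1| ≤ 1}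

theorem mem_horizontalCone {z : ℝ × ℝ} : z ∈ horizontalCone ↔ |z.2| ≤ |z.1| ∧ |z.1| ≤ 1 := Iff.rfl

theorem measurableSet_horizontalCone : MeasurableSet horizontalCone :=
  (measurableSet_le (by fun_prop) (by fun_prop)).inter
    (measurableSet_le (by fun_prop) (by fun_prop))

/-- The slice of the cone over x is |y| ≤ a, so y = a t carries it onto [-1,1] with Jacobian a; this
is the source of the factor s in polar integration. -/
theorem lintegral_indicator_horizontalCone {F : ℝ × ℝ → ℝ≥0∞} (hF : Measurable F) {a x : ℝ}
    (ha : 0 < a) (hx : |x| = a) :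
    ∫⁻ y, horizontalCone.indicator F (x, y) =
      if a ≤ 1 then ENNReal.ofReal a * ∫⁻ t in Set.Ioc (-1 : ℝ) 1, F (x, a * t) else 0 := by
  have hm : Measurable fun y => horizontalCone.indicator F (x, y) :=
    (hF.indicator measurableSet_horizontalCone).comp (by fun_prop)
  rw [lintegral_comp_mul_left_of_pos hm ha]
  split_ifs with h1
  · rw [setLIntegral_congr (μ := volume) Ioc_ae_eq_Icc, ← lintegral_indicator measurableSet_Icc]
    congr 1
    refine lintegral_congr fun t => ?_
    have : (x, a * t) ∈ horizontalCone ↔ t ∈ Set.Icc (-1 : ℝ) 1 := by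
      simp only [mem_horizontalCone, hx, abs_mul, abs_of_pos ha, h1, and_true, Set.mem_Icc,
        ← abs_le]
      exact mul_le_iff_le_one_right ha
    by_cases ht : t ∈ Set.Icc (-1 : ℝ) 1
    · rw [Set.indicator_of_mem (this.2 ht), Set.indicator_of_mem ht]
    · rw [Set.indicator_of_notMem (fun h => ht (this.1 h)), Set.indicator_of_notMem ht]
  · have : ∀ t, horizontalCone.indicator F (x, a * t) = 0 := fun t =>
      Set.indicator_of_notMem (fun h => h1 (hx ▸ h.2)) _
    simp [this]

/-- Tonelli over x = s and x = -s: these halves of the cone are swept out by the edges ξ = 1 and ξ =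
-1. -/
theorem lintegral_horizontalCone {F : ℝ × ℝ → ℝ≥0∞} (hF : Measurable F) :
    ∫⁻ z in horizontalCone, F z =
      ∫⁻ s in Set.Ioc (0 : ℝ) 1, ENNReal.ofReal s *
        ((∫⁻ t in Set.Ioc (-1 : ℝ) 1, F (s, s * t)) +
          ∫⁻ t in Set.Ioc (-1 : ℝ) 1, F (-s, s * t)) := by
  have hFi := hF.indicator measurableSet_horizontalCone
  have hm : Measurable fun x => ∫⁻ y, horizontalCone.indicator F (x, y) :=
    hFi.lintegral_prod_right'
  have half : ∀ c : ℝ → ℝ, (∀ s, 0 < s → |c s| = s) →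
      ∫⁻ x in Set.Ioi (0 : ℝ), (∫⁻ y, horizontalCone.indicator F (c x, y)) =
      ∫⁻ s in Set.Ioc (0 : ℝ) 1, ENNReal.ofReal s * ∫⁻ t in Set.Ioc (-1 : ℝ) 1, F (c s, s * t) := by
    intro c hc
    rw [setLIntegral_congr_fun measurableSet_Ioi
      (fun s (hs : 0 < s) => lintegral_indicator_horizontalCone hF hs (hc s hs)),
      ← lintegral_indicator measurableSet_Ioi, ← lintegral_indicator measurableSet_Ioc]
    refine lintegral_congr fun s => ?_
    by_cases h0 : 0 < s <;> by_cases h1 : s ≤ 1 <;> simp [Set.indicator, h0, h1]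
  have hneg : ∫⁻ x in Set.Iio (0 : ℝ), (∫⁻ y, horizontalCone.indicator F (x, y)) =
      ∫⁻ x in Set.Ioi (0 : ℝ), (∫⁻ y, horizontalCone.indicator F (-x, y)) := by
    have := (Measure.measurePreserving_neg (volume : Measure ℝ)).setLIntegral_comp_preimage
      (measurableSet_Iio (a := (0 : ℝ))) hm
    simpa using this.symm
  rw [← lintegral_indicator measurableSet_horizontalCone, Measure.volume_eq_prod,
    lintegral_prod _ hFi.aemeasurable, ← lintegral_add_compl _ (measurableSet_Ioi (a := (0 : ℝ))),
    Set.compl_Ioi, setLIntegral_congr (μ := volume) Iio_ae_eq_Iic.symm, hneg,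
    half (fun s => s) (fun s hs => abs_of_pos hs),
    half (fun s => -s) (fun s hs => by rw [abs_neg, abs_of_pos hs]), ← lintegral_add_left]
  · simp only [mul_add]
  · refine Measurable.mul (by fun_prop) ?_
    exact (hF.comp (by fun_prop : Measurable fun z : ℝ × ℝ => (z.1, z.1 * z.2))).lintegral_prod_right'

theorem volume_abs_eq_abs : volume {z : ℝ × ℝ | |z.2| = |z.1|} = 0 := by
  have hS : MeasurableSet {z : ℝ × ℝ | |z.2| = |z.1|} :=
    measurableSet_eq_fun (by fun_prop) (by fun_prop)
  rw [Measure.volume_eq_prod, Measure.measure_prod_null hS]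
  refine Filter.Eventually.of_forall fun x => ?_
  refine measure_mono_null (t := {x, -x}) (fun y hy => ?_) ((Set.toFinite _).measure_zero _)
  simpa using abs_eq_abs.1 hy

/-- Integration over the square in the coordinates `(x, y) = s (ξ, η)`, with `(ξ, η)` on the
boundary. -/
theorem lintegral_square {F : ℝ × ℝ → ℝ≥0∞} (hF : Measurable F) :
    ∫⁻ z in Set.Icc (-1 : ℝ) 1 ×ˢ Set.Icc (-1 : ℝ) 1, F z =
      ∫⁻ s in Set.Ioc (0 : ℝ) 1, ENNReal.ofReal s * ∫⁻ p, F (s • p) ∂boundaryMeasure := by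
  have hS : MeasurableSet {z : ℝ × ℝ | |z.2| ≤ |z.1|} :=
    measurableSet_le (by fun_prop) (by fun_prop)
  -- The diagonals cut the square into a horizontal and a vertical cone; the vertical one is the
  -- mirror image of the horizontal one up to the null set |x| = |y|.
  rw [← lintegral_add_compl _ hS, Measure.restrict_restrict hS, Measure.restrict_restrict hS.compl]
  have h1 : {z : ℝ × ℝ | |z.2| ≤ |z.1|} ∩ Set.Icc (-1 : ℝ) 1 ×ˢ Set.Icc (-1 : ℝ) 1 =
      horizontalCone := by
    ext ⟨x, y⟩
    change (|y| ≤ |x| ∧ (-1 ≤ x ∧ x ≤ 1) ∧ (-1 ≤ y ∧ y ≤ 1)) ↔ (|y| ≤ |x| ∧ |x| ≤ 1)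
    simp only [← abs_le]
    constructor
    · rintro ⟨h, h1, h2⟩; exact ⟨h, h1⟩
    · rintro ⟨h, h1⟩; exact ⟨h, h1, h.trans h1⟩
  have h2 : ({z : ℝ × ℝ | |z.2| ≤ |z.1|}ᶜ ∩ Set.Icc (-1 : ℝ) 1 ×ˢ Set.Icc (-1 : ℝ) 1 : Set (ℝ × ℝ))
      =ᵐ[volume] (Prod.swap ⁻¹' horizontalCone : Set (ℝ × ℝ)) := by
    have : ∀ᵐ z : ℝ × ℝ, ¬ |z.2| = |z.1| := by
      rw [ae_iff]; simpa using volume_abs_eq_abs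
    filter_upwards [this] with ⟨x, y⟩ h
    apply propext
    change (¬ |y| ≤ |x| ∧ (-1 ≤ x ∧ x ≤ 1) ∧ (-1 ≤ y ∧ y ≤ 1)) ↔ (|x| ≤ |y| ∧ |y| ≤ 1)
    simp only [← abs_le, not_le]
    constructor
    · rintro ⟨h, h1, h2⟩; exact ⟨h.le, h2⟩
    · rintro ⟨h', h1⟩; exact ⟨lt_of_le_of_ne h' (Ne.symm h), h'.trans h1, h1⟩
  rw [h1, setLIntegral_congr h2, lintegral_horizontalCone hF]
  have h3 : ∫⁻ z in Prod.swap ⁻¹' horizontalCone, F z =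
      ∫⁻ z in horizontalCone, (F ∘ Prod.swap) z := by
    have hp : MeasurePreserving (Prod.swap : ℝ × ℝ → ℝ × ℝ) volume volume :=
      Measure.measurePreserving_swap
    have := hp.setLIntegral_comp_preimage measurableSet_horizontalCone (hF.comp measurable_swap)
    simpa using this
  rw [h3, lintegral_horizontalCone (hF.comp measurable_swap), ← lintegral_add_left]
  · refine lintegral_congr fun s => ?_
    rw [lintegral_boundaryMeasure (show Measurable fun p : ℝ × ℝ => F (s • p) from
      hF.comp (by fun_prop)), ← mul_add]
    simp only [Prod.smul_mk, smul_eq_mul, mul_one, mul_neg, Function.comp_apply, Prod.swap_prod_mk]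
    rw [add_comm]
  · refine Measurable.mul (by fun_prop) (Measurable.add ?_ ?_)
    · exact (hF.comp (by fun_prop : Measurable fun z : ℝ × ℝ => (z.1, z.1 * z.2))).lintegral_prod_right'
    · exact (hF.comp (by fun_prop : Measurable fun z : ℝ × ℝ => (-z.1, z.1 * z.2))).lintegral_prod_right'

/-! ### The weighted measure as a product in polar coordinates -/

/-- The measure `s w(s) ds` on `(0,1]`. -/
def radialMeasure (w : ℝ → ℝ) : Measure ℝ :=
  (volume.restrict (Set.Ioc (0 : ℝ) 1)).withDensity fun s => ENNReal.ofReal (s * w s)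

instance (w : ℝ → ℝ) : SFinite (radialMeasure w) := by
  unfold radialMeasure; infer_instance

theorem max_abs_smul {s : ℝ} (hs : 0 ≤ s) {p : ℝ × ℝ} (hp : max |p.1| |p.2| = 1) :
    max |(s • p).1| |(s • p).2| = s := by
  simp only [Prod.smul_fst, Prod.smul_snd, smul_eq_mul, abs_mul, abs_of_nonneg hs]
  rw [← mul_max_of_nonneg _ _ hs, hp, mul_one]

/-- By polar integration, a null set of radii pulls back to a null set of the square. This allows w,
which is only almost everywhere measurable, to be replaced by a measurable version. -/
theorem squareMeasure_congr {w v : ℝ → ℝ} (h : w =ᵐ[volume.restrict (Set.Ioc (0 : ℝ) 1)] v) :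
    squareMeasure w = squareMeasure v := by
  refine withDensity_congr_ae ?_
  obtain ⟨N, hN, hNm, hN0⟩ := exists_measurable_superset_of_null (ae_iff.1 h)
  have hm : MeasurableSet {z : ℝ × ℝ | max |z.1| |z.2| ∈ N} := by
    exact (show Measurable fun z : ℝ × ℝ => max |z.1| |z.2| by fun_prop) hNm
  have : volume.restrict (Set.Icc (-1 : ℝ) 1 ×ˢ Set.Icc (-1 : ℝ) 1)
      {z : ℝ × ℝ | max |z.1| |z.2| ∈ N} = 0 := by
    rw [← lintegral_indicator_one hm, lintegral_square (measurable_one.indicator hm),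
      lintegral_eq_zero_iff']
    · filter_upwards [ae_restrict_mem measurableSet_Ioc, measure_eq_zero_iff_ae_notMem.1 hN0] with s hs hsN
      have : ∫⁻ p, {z : ℝ × ℝ | max |z.1| |z.2| ∈ N}.indicator (1 : ℝ × ℝ → ℝ≥0∞) (s • p)
          ∂boundaryMeasure = 0 := by
        rw [← lintegral_zero (μ := boundaryMeasure)]
        refine lintegral_congr_ae ?_
        filter_upwards [ae_boundaryMeasure_max_abs] with p hp
        refine Set.indicator_of_notMem (fun hmem => hsN ?_) _
        have h' : max |(s • p).1| |(s • p).2| ∈ N := hmem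
        rwa [max_abs_smul hs.1.le hp] at h'
      simp only [this, mul_zero, Pi.zero_apply]
    · refine AEMeasurable.mul (by fun_prop) (Measurable.aemeasurable ?_)
      exact ((measurable_one.indicator hm).comp
        (by fun_prop : Measurable fun z : ℝ × ℝ × ℝ => z.1 • z.2)).lintegral_prod_right'
  filter_upwards [measure_eq_zero_iff_ae_notMem.1 this] with z hz
  by_contra hne
  exact hz (hN (fun h' => hne (by rw [h'])))

theorem radialMeasure_congr {w v : ℝ → ℝ} (h : w =ᵐ[volume.restrict (Set.Ioc (0 : ℝ) 1)] v) :
    radialMeasure w = radialMeasure v := by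
  refine withDensity_congr_ae ?_
  filter_upwards [h] with s hs
  rw [hs]

theorem squareMeasure_eq_map_of_measurable {w : ℝ → ℝ} (hw : Measurable w) :
    squareMeasure w = ((radialMeasure w).prod boundaryMeasure).map fun z => z.1 • z.2 := by
  refine Measure.ext_of_lintegral _ fun F hF => ?_
  have hd : Measurable fun z : ℝ × ℝ => ENNReal.ofReal (w (max |z.1| |z.2|)) :=
    (hw.comp (by fun_prop)).ennreal_ofReal
  have hFs : Measurable fun z : ℝ × ℝ × ℝ => F (z.1 • z.2) := hF.comp (by fun_prop)
  rw [lintegral_map hF (by fun_prop), lintegral_prod _ hFs.aemeasurable, squareMeasure, radialMeasure,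
    lintegral_withDensity_eq_lintegral_mul _ hd hF,
    lintegral_withDensity_eq_lintegral_mul _ (by fun_prop) hFs.lintegral_prod_right',
    lintegral_square (hd.mul hF)]
  refine setLIntegral_congr_fun measurableSet_Ioc fun s hs => ?_
  simp only [Pi.mul_apply]
  rw [ENNReal.ofReal_mul hs.1.le, mul_assoc, ← lintegral_const_mul _ (show Measurable
    fun p : ℝ × ℝ => F (s • p) from hF.comp (by fun_prop))]
  congr 1
  refine lintegral_congr_ae ?_
  filter_upwards [ae_boundaryMeasure_max_abs] with p hp
  rw [max_abs_smul hs.1.le hp]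

/-- Integrability of t w(t) gives measurability of the product, and t is invertible on (0,1]. -/
theorem IsRadialWeight.aemeasurable {w : ℝ → ℝ} (hw : IsRadialWeight w) :
    AEMeasurable w (volume.restrict (Set.Ioc (0 : ℝ) 1)) := by
  have h := (hw.integrable.mono_set Set.Ioc_subset_Icc_self).aestronglyMeasurable.aemeasurable
  refine ((measurable_inv.aemeasurable (μ := volume.restrict (Set.Ioc (0 : ℝ) 1))).mul h).congr ?_
  filter_upwards [ae_restrict_mem measurableSet_Ioc] with t ht
  simp [ht.1.ne']

theorem IsRadialWeight.squareMeasure_eq_map {w : ℝ → ℝ} (hw : IsRadialWeight w) :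
    squareMeasure w = ((radialMeasure w).prod boundaryMeasure).map fun z => z.1 • z.2 := by
  have h := hw.aemeasurable.ae_eq_mk
  rw [squareMeasure_congr h, radialMeasure_congr h,
    squareMeasure_eq_map_of_measurable hw.aemeasurable.measurable_mk]

theorem IsRadialWeight.isFiniteMeasure_radialMeasure {w : ℝ → ℝ} (hw : IsRadialWeight w) :
    IsFiniteMeasure (radialMeasure w) :=
  isFiniteMeasure_withDensity_ofReal
    (hw.integrable.mono_set Set.Ioc_subset_Icc_self).hasFiniteIntegral

theorem IsRadialWeight.isFiniteMeasure_squareMeasure {w : ℝ → ℝ} (hw : IsRadialWeight w) :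
    IsFiniteMeasure (squareMeasure w) := by
  have := hw.isFiniteMeasure_radialMeasure
  rw [hw.squareMeasure_eq_map]
  infer_instance

theorem IsRadialWeight.integral_radialMeasure {w : ℝ → ℝ} (hw : IsRadialWeight w) (g : ℝ → ℝ) :
    ∫ s, g s ∂radialMeasure w = ∫ s in (0 : ℝ)..1, g s * (s * w s) := by
  rw [radialMeasure, integral_withDensity_eq_integral_toReal_smul₀, intervalIntegral.integral_of_le
    zero_le_one]
  · refine setIntegral_congr_fun measurableSet_Ioc fun s hs => ?_
    simp only [smul_eq_mul]
    rw [ENNReal.toReal_ofReal (mul_nonneg hs.1.le (hw.nonneg s ⟨hs.1.le, hs.2⟩)), mul_comm]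
  · exact (measurable_id.aemeasurable.mul hw.aemeasurable).ennreal_ofReal
  · exact Filter.Eventually.of_forall fun _ => ENNReal.ofReal_lt_top

theorem ae_radialMeasure (w : ℝ → ℝ) : ∀ᵐ s ∂radialMeasure w, s ∈ Set.Ioc (0 : ℝ) 1 :=
  (withDensity_absolutelyContinuous _ _).ae_le (ae_restrict_mem measurableSet_Ioc)

theorem IsRadialWeight.radialMeasure_ne_zero {w : ℝ → ℝ} (hw : IsRadialWeight w) :
    radialMeasure w ≠ 0 := by
  intro h
  refine hw.not_ae_zero ?_
  rw [radialMeasure, withDensity_eq_zero_iff (show AEMeasurable (fun s => ENNReal.ofReal (s * w s)) _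
    from (measurable_id.aemeasurable.mul hw.aemeasurable).ennreal_ofReal)] at h
  rw [← restrict_Ioc_eq_restrict_Icc]
  filter_upwards [h, ae_restrict_mem measurableSet_Ioc] with s hs hs'
  have h0 := hw.nonneg s ⟨hs'.1.le, hs'.2⟩
  simp only [Pi.zero_apply, ENNReal.ofReal_eq_zero] at hs
  nlinarith [hs'.1]

/-! ### The boundary form and its definiteness modulo the ideal -/

/-- Evaluation of a polynomial at a point of the plane. -/
def evalPair (p : MvPolynomial (Fin 2) ℝ) (z : ℝ × ℝ) : ℝ := MvPolynomial.eval ![z.1, z.2] p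

theorem continuous_evalPair (p : MvPolynomial (Fin 2) ℝ) : Continuous (evalPair p) :=
  (MvPolynomial.continuous_eval p).comp (by fun_prop)

@[simp] theorem evalPair_add (p q : MvPolynomial (Fin 2) ℝ) (z : ℝ × ℝ) :
    evalPair (p + q) z = evalPair p z + evalPair q z := by simp [evalPair]

@[simp] theorem evalPair_smul (c : ℝ) (p : MvPolynomial (Fin 2) ℝ) (z : ℝ × ℝ) :
    evalPair (c • p) z = c * evalPair p z := by simp [evalPair, MvPolynomial.smul_eval]

@[simp] theorem evalPair_sub (p q : MvPolynomial (Fin 2) ℝ) (z : ℝ × ℝ) :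
    evalPair (p - q) z = evalPair p z - evalPair q z := by simp [evalPair]

theorem boundaryForm_eq_integral (p q : MvPolynomial (Fin 2) ℝ) :
    boundaryForm p q = ∫ z, evalPair p z * evalPair q z ∂boundaryMeasure := by
  exact (integral_boundaryMeasure ((continuous_evalPair p).mul (continuous_evalPair q))).symm

theorem boundaryForm_comm (p q : MvPolynomial (Fin 2) ℝ) :
    boundaryForm p q = boundaryForm q p := by
  simp only [boundaryForm_eq_integral, mul_comm]

theorem boundaryForm_add_left (p p' q : MvPolynomial (Fin 2) ℝ) :
    boundaryForm (p + p') q = boundaryForm p q + boundaryForm p' q := by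
  simp only [boundaryForm_eq_integral, evalPair_add, add_mul]
  exact integral_add
    (integrable_boundaryMeasure ((continuous_evalPair p).mul (continuous_evalPair q)))
    (integrable_boundaryMeasure ((continuous_evalPair p').mul (continuous_evalPair q)))

theorem boundaryForm_smul_left (c : ℝ) (p q : MvPolynomial (Fin 2) ℝ) :
    boundaryForm (c • p) q = c * boundaryForm p q := by
  simp only [boundaryForm_eq_integral, evalPair_smul, mul_assoc]
  exact integral_const_mul _ _

/-- `boundaryForm` as a bilinear form. -/
def boundaryBilin : LinearMap.BilinForm ℝ (MvPolynomial (Fin 2) ℝ) :=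
  LinearMap.mk₂ ℝ boundaryForm boundaryForm_add_left
    (fun c p q => boundaryForm_smul_left c p q)
    (fun p q q' => by
      rw [boundaryForm_comm, boundaryForm_add_left, boundaryForm_comm q, boundaryForm_comm q'])
    (fun c p q => by
      rw [boundaryForm_comm, boundaryForm_smul_left, boundaryForm_comm q, smul_eq_mul])

theorem boundaryBilin_apply (p q : MvPolynomial (Fin 2) ℝ) :
    boundaryBilin p q = boundaryForm p q := rfl

theorem evalPair_eq_zero_of_mem {p : MvPolynomial (Fin 2) ℝ} (hp : p ∈ boundaryIdeal)
    {z : ℝ × ℝ} (hz : max |z.1| |z.2| = 1) : evalPair p z = 0 := by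
  obtain ⟨q, rfl⟩ := Ideal.mem_span_singleton.1 hp
  have h : (1 - z.1 ^ 2) * (1 - z.2 ^ 2) = 0 := by
    rcases max_choice |z.1| |z.2| with h | h
    · rw [← sq_abs z.1, ← h, hz]; ring
    · rw [← sq_abs z.2, ← h, hz]; ring
  simp [evalPair, h]

theorem modBoundary_eq_zero {p : MvPolynomial (Fin 2) ℝ} :
    modBoundary p = 0 ↔ p ∈ boundaryIdeal := Ideal.Quotient.eq_zero_iff_mem

theorem evalPair_congr {p q : MvPolynomial (Fin 2) ℝ} (h : modBoundary p = modBoundary q)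
    {z : ℝ × ℝ} (hz : max |z.1| |z.2| = 1) : evalPair p z = evalPair q z := by
  rw [← sub_eq_zero, ← evalPair_sub]
  exact evalPair_eq_zero_of_mem (modBoundary_eq_zero.1 (by rw [map_sub, h, sub_self])) hz

theorem boundaryForm_congr {p p' q q' : MvPolynomial (Fin 2) ℝ}
    (hp : modBoundary p = modBoundary p') (hq : modBoundary q = modBoundary q') :
    boundaryForm p q = boundaryForm p' q' := by
  rw [boundaryForm_eq_integral, boundaryForm_eq_integral]
  refine integral_congr_ae ?_
  filter_upwards [ae_boundaryMeasure_max_abs] with z hz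
  rw [evalPair_congr hp hz, evalPair_congr hq hz]

/-- Substitution of the constant `c` for the variable `i`, and of `X` for the other one. -/
def edgeHom (i : Fin 2) (c : ℝ) : MvPolynomial (Fin 2) ℝ →ₐ[ℝ] Polynomial ℝ :=
  MvPolynomial.aeval (Function.update (fun _ => Polynomial.X) i (Polynomial.C c))

/-- Modulo X_i - c the quotient map factors through the substitution, so whatever the substitution
kills lies in the ideal. -/
theorem dvd_of_edgeHom_eq_zero {i : Fin 2} {c : ℝ} {p : MvPolynomial (Fin 2) ℝ}
    (h : edgeHom i c p = 0) : MvPolynomial.X i - MvPolynomial.C c ∣ p := by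
  rw [← Ideal.mem_span_singleton, ← Ideal.Quotient.eq_zero_iff_mem]
  set I := Ideal.span {(MvPolynomial.X i - MvPolynomial.C c : MvPolynomial (Fin 2) ℝ)}
  have key : Ideal.Quotient.mkₐ ℝ I = ((Ideal.Quotient.mkₐ ℝ I).comp
      (Polynomial.aeval (MvPolynomial.X (i + 1)))).comp (edgeHom i c) := by
    refine MvPolynomial.algHom_ext fun j => ?_
    by_cases hj : j = i
    · subst hj
      simp only [edgeHom, AlgHom.comp_apply, MvPolynomial.aeval_X, Function.update_self,
        Polynomial.aeval_C]
      exact Ideal.Quotient.eq.2 (Ideal.mem_span_singleton_self _)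
    -- In `Fin 2`, `i + 1` is the other variable.
    · have : i + 1 = j := by omega
      simp [edgeHom, AlgHom.comp_apply, MvPolynomial.aeval_X, Function.update_of_ne hj, this]
  have := DFunLike.congr_fun key p
  simp only [AlgHom.comp_apply, h, map_zero] at this
  exact this

theorem eval_edgeHom (i : Fin 2) (c t : ℝ) (p : MvPolynomial (Fin 2) ℝ) :
    (edgeHom i c p).eval t = MvPolynomial.eval (Function.update (fun _ => t) i c) p := by
  have : (Polynomial.evalRingHom t).comp (edgeHom i c).toRingHom =
      MvPolynomial.eval (Function.update (fun _ => t) i c) := by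
    refine MvPolynomial.ringHom_ext (fun r => by simp [edgeHom]) fun j => ?_
    by_cases hj : j = i
    · subst hj; simp [edgeHom]
    · simp [edgeHom, Function.update_of_ne hj]
  exact DFunLike.congr_fun this p

theorem edgeHom_zero_eval (c t : ℝ) (p : MvPolynomial (Fin 2) ℝ) :
    (edgeHom 0 c p).eval t = evalPair p (c, t) := by
  rw [eval_edgeHom, evalPair]; congr 2; ext j; fin_cases j <;> simp

theorem edgeHom_one_eval (c t : ℝ) (p : MvPolynomial (Fin 2) ℝ) :
    (edgeHom 1 c p).eval t = evalPair p (t, c) := by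
  rw [eval_edgeHom, evalPair]; congr 2; ext j; fin_cases j <;> simp

/-- The four linear factors are split off one at a time. A factor already removed does not restrict
to zero on the next edge, as its value at 0 shows, so the cofactor does. -/
theorem mem_boundaryIdeal_of_edgeHom {p : MvPolynomial (Fin 2) ℝ}
    (h : ∀ i, edgeHom i 1 p = 0 ∧ edgeHom i (-1) p = 0) : p ∈ boundaryIdeal := by
  obtain ⟨p₁, rfl⟩ := dvd_of_edgeHom_eq_zero (h 0).1
  have h2 : edgeHom 0 (-1) p₁ = 0 := by
    have := (h 0).2
    rw [map_mul] at this
    refine (mul_eq_zero.1 this).resolve_left fun h0 => ?_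
    have := congrArg (Polynomial.eval 0) h0
    norm_num [edgeHom_zero_eval, evalPair] at this
  obtain ⟨p₂, rfl⟩ := dvd_of_edgeHom_eq_zero h2
  have h3 : ∀ c, edgeHom 1 c ((MvPolynomial.X 0 - MvPolynomial.C 1) *
      ((MvPolynomial.X 0 - MvPolynomial.C (-1)) * p₂)) = 0 → edgeHom 1 c p₂ = 0 := by
    intro c hc
    rw [← mul_assoc, map_mul] at hc
    refine (mul_eq_zero.1 hc).resolve_left fun h0 => ?_
    have := congrArg (Polynomial.eval 0) h0
    norm_num [edgeHom_one_eval, evalPair] at this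
  obtain ⟨p₃, rfl⟩ := dvd_of_edgeHom_eq_zero (h3 _ (h 1).1)
  have h4 : edgeHom 1 (-1) p₃ = 0 := by
    have := h3 _ (h 1).2
    rw [map_mul] at this
    refine (mul_eq_zero.1 this).resolve_left fun h0 => ?_
    have := congrArg (Polynomial.eval 0) h0
    norm_num [edgeHom_one_eval, evalPair] at this
  obtain ⟨p₄, rfl⟩ := dvd_of_edgeHom_eq_zero h4
  refine Ideal.mem_span_singleton.2 ⟨p₄, ?_⟩
  simp only [map_neg, map_one]
  ring

theorem polynomial_eq_zero_of_ae_eval {f : Polynomial ℝ}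
    (h : ∀ᵐ t ∂volume.restrict (Set.Ioc (-1 : ℝ) 1), f.eval t = 0) : f = 0 := by
  by_contra hf
  have hfin : {t | f.IsRoot t}.Finite := Polynomial.finite_setOfPred_isRoot hf
  have h2 : ∀ᵐ t ∂volume.restrict (Set.Ioc (-1 : ℝ) 1), False := by
    filter_upwards [h, ae_restrict_of_ae (measure_eq_zero_iff_ae_notMem.1 (hfin.measure_zero volume))]
      with t h1 h2 using h2 h1
  have h3 := ae_iff.1 h2
  norm_num at h3

/-- A zero integral of p² makes p vanish almost everywhere on each edge. There p is a polynomial in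
one variable, hence identically zero. -/
theorem mem_boundaryIdeal_of_boundaryForm_self {p : MvPolynomial (Fin 2) ℝ}
    (h : boundaryForm p p = 0) : p ∈ boundaryIdeal := by
  have hc := (continuous_evalPair p).mul (continuous_evalPair p)
  rw [boundaryForm_eq_integral, integral_eq_zero_iff_of_nonneg (fun z => mul_self_nonneg _)
    (integrable_boundaryMeasure hc)] at h
  have h' : ∀ᵐ z ∂boundaryMeasure, evalPair p z = 0 := by
    filter_upwards [h] with z hz using mul_self_eq_zero.1 hz
  simp only [boundaryMeasure, ae_add_measure_iff] at h'
  have key : ∀ (g : ℝ → ℝ × ℝ), Measurable g →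
      (∀ᵐ z ∂(volume.restrict (Set.Ioc (-1 : ℝ) 1)).map g, evalPair p z = 0) → ∀ i c,
      (∀ t, (edgeHom i c p).eval t = evalPair p (g t)) → edgeHom i c p = 0 := by
    intro g hg hz i c hi
    refine polynomial_eq_zero_of_ae_eval ?_
    filter_upwards [ae_of_ae_map hg.aemeasurable hz] with t ht
    rw [hi, ht]
  refine mem_boundaryIdeal_of_edgeHom fun i => ?_
  fin_cases i
  · exact ⟨key _ (by fun_prop) h'.2.1 _ _ fun t => edgeHom_zero_eval _ _ _,
      key _ (by fun_prop) h'.2.2 _ _ fun t => edgeHom_zero_eval _ _ _⟩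
  · exact ⟨key _ (by fun_prop) h'.1.1 _ _ fun t => edgeHom_one_eval _ _ _,
      key _ (by fun_prop) h'.1.2 _ _ fun t => edgeHom_one_eval _ _ _⟩

/-! ### Decomposition of boundary polynomials by degree -/

/-- Orthogonal projection onto a finite-dimensional subspace, for a symmetric bilinear form whose
isotropic vectors lie in the radical. -/
theorem exists_sub_orthogonal_span {V : Type*} [AddCommGroup V] [Module ℝ V]
    (B : LinearMap.BilinForm ℝ V) (hB : ∀ x y, B x y = B y x)
    (h0 : ∀ x, B x x = 0 → ∀ y, B x y = 0) (S : Finset V) (v : V) :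
    ∃ u ∈ Submodule.span ℝ (S : Set V), ∀ x ∈ Submodule.span ℝ (S : Set V), B (v - u) x = 0 := by
  classical
  induction S using Finset.induction_on generalizing v with
  | empty => exact ⟨0, zero_mem _, fun x hx => by
      rw [Finset.coe_empty, Submodule.span_empty, Submodule.mem_bot] at hx
      rw [hx, map_zero]⟩
  | insert e S _ ih =>
    obtain ⟨a, ha, hea⟩ := ih e
    obtain ⟨b, hb, hvb⟩ := ih v
    have hle : Submodule.span ℝ (S : Set V) ≤ Submodule.span ℝ (insert e S : Finset V) :=
      Submodule.span_mono (by simp)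
    have hd : e - a ∈ Submodule.span ℝ ((insert e S : Finset V) : Set V) :=
      sub_mem (Submodule.subset_span (by simp)) (hle ha)
    -- Gram–Schmidt: e - a is the component of e orthogonal to the previous span.
    refine ⟨b + (B v (e - a) / B (e - a) (e - a)) • (e - a),
      add_mem (hle hb) (Submodule.smul_mem _ _ hd), fun x hx => ?_⟩
    rw [Finset.coe_insert, Submodule.mem_span_insert] at hx
    obtain ⟨r, y, hy, rfl⟩ := hx
    have h1 : r • e + y = r • (e - a) + (r • a + y) := by module
    have hy' : r • a + y ∈ Submodule.span ℝ (S : Set V) :=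
      add_mem (Submodule.smul_mem _ _ ha) hy
    have h2 := hvb _ hy'
    have h3 := hea _ hy'
    have h4 : B b (e - a) = 0 := by rw [hB]; exact hea _ hb
    rw [h1]
    generalize r • a + y = q at *
    -- The form is degenerate on polynomials before passing to the quotient. An isotropic e - a lies
    -- in the radical; the coefficient is then 0, as a division by zero, and b alone is the
    -- projection.
    by_cases hz : B (e - a) (e - a) = 0
    · have h5 := h0 _ hz v
      rw [hB] at h5
      simp only [map_sub, map_add, map_smul, LinearMap.sub_apply, LinearMap.add_apply,
        LinearMap.smul_apply, smul_eq_mul] at *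
      simp only [hz, div_zero]
      linear_combination r * h5 - r * h4 + h2
    · have h6 : B v (e - a) / B (e - a) (e - a) * B (e - a) (e - a) = B v (e - a) :=
        div_mul_cancel₀ _ hz
      have : B (v - (b + (B v (e - a) / B (e - a) (e - a)) • (e - a))) (r • (e - a) + q) =
          r * (B v (e - a) - B b (e - a) - B v (e - a) / B (e - a) (e - a) * B (e - a) (e - a)) +
          (B (v - b) q - B v (e - a) / B (e - a) (e - a) * B (e - a) q) := by
        generalize e - a = d
        simp only [map_sub, map_add, map_smul, LinearMap.sub_apply, LinearMap.add_apply,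
          LinearMap.smul_apply, smul_eq_mul]
        ring
      rw [this, h6, h4, h2, h3]
      ring

theorem exists_sub_boundaryOrthogonal (n : ℕ) (p : MvPolynomial (Fin 2) ℝ) :
    ∃ u : MvPolynomial (Fin 2) ℝ, u.totalDegree ≤ n ∧
      ∀ q : MvPolynomial (Fin 2) ℝ, q.totalDegree ≤ n → boundaryForm (p - u) q = 0 := by
  have hfg : (MvPolynomial.restrictTotalDegree (Fin 2) ℝ n).FG := by
    rw [← Module.Finite.iff_fg]
    infer_instance
  obtain ⟨S, hS⟩ := hfg
  obtain ⟨u, hu, h⟩ := exists_sub_orthogonal_span boundaryBilin boundaryForm_comm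
    (fun x hx y => by
      have hx0 := modBoundary_eq_zero.2 (mem_boundaryIdeal_of_boundaryForm_self hx)
      rw [boundaryBilin_apply, boundaryForm_congr (hx0.trans (map_zero modBoundary).symm) rfl,
        ← boundaryBilin_apply, map_zero, LinearMap.zero_apply]) S p
  rw [hS] at hu h
  simp only [MvPolynomial.mem_restrictTotalDegree] at hu h
  exact ⟨u, hu, h⟩

/-- The polynomials orthogonal of degree `n` on the boundary form a subspace. -/
def boundaryOrthogonalSubmodule (n : ℕ) : Submodule ℝ (MvPolynomial (Fin 2) ℝ) where
  carrier := {p | IsBoundaryOrthogonal n p}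
  zero_mem' := ⟨by simp, fun q _ => by
    rw [← boundaryBilin_apply, map_zero, LinearMap.zero_apply]⟩
  add_mem' := fun {p q} hp hq => ⟨(MvPolynomial.totalDegree_add p q).trans (max_le hp.1 hq.1),
    fun r hr => by rw [boundaryForm_add_left, hp.2 r hr, hq.2 r hr, add_zero]⟩
  smul_mem' := fun c p hp => ⟨(MvPolynomial.totalDegree_smul_le c p).trans hp.1,
    fun r hr => by rw [boundaryForm_smul_left, hp.2 r hr, mul_zero]⟩

theorem mem_boundaryBV {n : ℕ} {x : MvPolynomial (Fin 2) ℝ ⧸ boundaryIdeal} :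
    x ∈ boundaryBV n ↔ ∃ p, IsBoundaryOrthogonal n p ∧ modBoundary p = x := by
  have : boundaryBV n = (boundaryOrthogonalSubmodule n).map modBoundary := by
    rw [boundaryBV, ← Submodule.span_eq (boundaryOrthogonalSubmodule n), Submodule.map_span]
    rfl
  rw [this]
  exact Submodule.mem_map

theorem boundaryForm_eq_zero_of_ne {m n : ℕ} (h : m ≠ n) {p q : MvPolynomial (Fin 2) ℝ}
    (hp : modBoundary p ∈ boundaryBV m) (hq : modBoundary q ∈ boundaryBV n) :
    boundaryForm p q = 0 := by
  obtain ⟨p', hp', hpp⟩ := mem_boundaryBV.1 hp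
  obtain ⟨q', hq', hqq⟩ := mem_boundaryBV.1 hq
  rw [boundaryForm_congr hpp.symm hqq.symm]
  rcases lt_or_gt_of_ne h with h | h
  · rw [boundaryForm_comm]
    exact hq'.2 _ (hp'.1.trans_lt h)
  · exact hp'.2 _ (hq'.1.trans_lt h)

/-- Subtracting the projection onto degree at most n leaves an orthogonal polynomial of degree n +
1; the projection is covered by induction. -/
theorem modBoundary_mem_iSup (n : ℕ) (p : MvPolynomial (Fin 2) ℝ) (hp : p.totalDegree ≤ n) :
    modBoundary p ∈ ⨆ m ≤ n, boundaryBV m := by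
  induction n generalizing p with
  | zero =>
    refine Submodule.mem_iSup_of_mem 0 (Submodule.mem_iSup_of_mem le_rfl ?_)
    exact mem_boundaryBV.2 ⟨p, ⟨hp, fun q hq => absurd hq (Nat.not_lt_zero _)⟩, rfl⟩
  | succ n ih =>
    obtain ⟨u, hu, h⟩ := exists_sub_boundaryOrthogonal n p
    have h1 : modBoundary (p - u) ∈ ⨆ m ≤ n + 1, boundaryBV m := by
      refine Submodule.mem_iSup_of_mem (n + 1) (Submodule.mem_iSup_of_mem le_rfl ?_)
      refine mem_boundaryBV.2 ⟨p - u, ⟨?_, fun q hq => h q (Nat.lt_succ_iff.1 hq)⟩, rfl⟩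
      exact (MvPolynomial.totalDegree_sub p u).trans (max_le hp (hu.trans n.le_succ))
    have h2 : modBoundary u ∈ ⨆ m ≤ n + 1, boundaryBV m :=
      (biSup_mono fun m hm => hm.trans n.le_succ :
        ⨆ m ≤ n, boundaryBV m ≤ ⨆ m ≤ n + 1, boundaryBV m) (ih u hu)
    have := add_mem h1 h2
    rwa [← map_add, sub_add_cancel] at this

theorem IsBoundaryOrthogonalBasis.mem_boundaryBV {n : ℕ} {ι : Type*}
    {Y : ι → MvPolynomial (Fin 2) ℝ} (hY : IsBoundaryOrthogonalBasis n Y) (i : ι) :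
    modBoundary (Y i) ∈ boundaryBV n := by
  rw [← hY.span_eq]
  exact Submodule.subset_span ⟨i, rfl⟩

theorem IsBoundaryOrthogonalBasis.boundaryForm_self_ne_zero {n : ℕ} {ι : Type*}
    {Y : ι → MvPolynomial (Fin 2) ℝ} (hY : IsBoundaryOrthogonalBasis n Y) (i : ι) :
    boundaryForm (Y i) (Y i) ≠ 0 := fun h =>
  hY.linearIndependent.ne_zero i
    (modBoundary_eq_zero.2 (mem_boundaryIdeal_of_boundaryForm_self h))

/-- On the boundary, a polynomial of degree at most `n` is a linear combination of the members of
the orthogonal bases of degree at most `n`. -/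
theorem exists_mem_span_modBoundary_eq {ι : ℕ → Type*} {Y : (m : ℕ) → ι m → MvPolynomial (Fin 2) ℝ}
    (hY : ∀ m, IsBoundaryOrthogonalBasis m (Y m)) {n : ℕ} {p : MvPolynomial (Fin 2) ℝ}
    (hp : p.totalDegree ≤ n) :
    ∃ p' ∈ Submodule.span ℝ {q | ∃ m ≤ n, ∃ i, Y m i = q}, modBoundary p' = modBoundary p := by
  rw [← Submodule.mem_map]
  refine (iSup₂_le fun m hm => ?_ : ⨆ m ≤ n, boundaryBV m ≤ _) (modBoundary_mem_iSup n p hp)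
  rw [← (hY m).span_eq, Submodule.span_le]
  rintro _ ⟨i, rfl⟩
  exact Submodule.mem_map_of_mem (Submodule.subset_span ⟨m, hm, i, rfl⟩)

/-! ### Density of polynomials -/

/-- Polynomials are dense in `L²` of a finite measure carried by a compact subset of the plane. -/
theorem topologicalClosure_eq_top_of_evalPair_mem {μ : Measure (ℝ × ℝ)} [IsFiniteMeasure μ]
    {K : Set (ℝ × ℝ)} (hK : IsCompact K) (hμ : ∀ᵐ z ∂μ, z ∈ K) (M : Submodule ℝ (Lp ℝ 2 μ))
    (hM : ∀ (p : MvPolynomial (Fin 2) ℝ) (hp : MemLp (evalPair p) 2 μ), hp.toLp ∈ M) :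
    M.topologicalClosure = ⊤ := by
  rw [eq_top_iff]
  have hd : Dense (Lp.boundedContinuousFunction ℝ 2 μ : Set (Lp ℝ 2 μ)) :=
    Lp.boundedContinuousFunction_dense ℝ μ (by norm_num)
  have hsub : (Lp.boundedContinuousFunction ℝ 2 μ : Set (Lp ℝ 2 μ)) ⊆ M.topologicalClosure := by
    intro f hf
    obtain ⟨g, hg⟩ := Lp.mem_boundedContinuousFunction_iff.1 hf
    let A : Subalgebra ℝ C(ℝ × ℝ, ℝ) := (MvPolynomial.aeval
      ![(⟨Prod.fst, continuous_fst⟩ : C(ℝ × ℝ, ℝ)), ⟨Prod.snd, continuous_snd⟩]).range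
    have hev : ∀ p z, (MvPolynomial.aeval
        ![(⟨Prod.fst, continuous_fst⟩ : C(ℝ × ℝ, ℝ)), ⟨Prod.snd, continuous_snd⟩] p) z =
        evalPair p z := by
      intro p z
      induction p using MvPolynomial.induction_on with
      | C a => simp [evalPair]
      | add p q hp hq => simp [hp, hq]
      | mul_X p i hp =>
        have : evalPair (p * MvPolynomial.X i) z = evalPair p z * ![z.1, z.2] i := by
          simp [evalPair]
        rw [this, map_mul, ContinuousMap.mul_apply, hp, MvPolynomial.aeval_X]
        fin_cases i <;> rfl
    have hA : A.SeparatesPoints := by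
      intro x y hxy
      by_cases h : x.1 = y.1
      · refine ⟨_, ⟨_, ⟨MvPolynomial.X 1, rfl⟩, rfl⟩, ?_⟩
        have h2 : x.2 ≠ y.2 := fun h' => hxy (Prod.ext h h')
        simpa using h2
      · refine ⟨_, ⟨_, ⟨MvPolynomial.X 0, rfl⟩, rfl⟩, ?_⟩
        simpa using h
    rw [Submodule.topologicalClosure_coe, Metric.mem_closure_iff]
    intro ε hε
    set c : ℝ := (measureUnivNNReal μ : ℝ) ^ (2 : ENNReal).toReal⁻¹ with hc
    have hc0 : 0 ≤ c := by positivity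
    -- The L² norm is at most c times the uniform bound on K; c + 1 keeps the quotient defined for μ
    -- = 0 and makes the final inequality strict.
    have hδ : 0 < ε / (c + 1) := by positivity
    obtain ⟨_, ⟨p, rfl⟩, hp⟩ :=
      ContinuousMap.exists_mem_subalgebra_near_continuous_of_isCompact_of_separatesPoints hA
        g.toContinuousMap hK hδ
    obtain ⟨C, hC⟩ := hK.exists_bound_of_continuousOn (continuous_evalPair p).continuousOn
    have hpL : MemLp (evalPair p) 2 μ :=
      MemLp.of_bound (continuous_evalPair p).aestronglyMeasurable C (hμ.mono hC)
    refine ⟨hpL.toLp, hM p hpL, ?_⟩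
    rw [dist_eq_norm]
    have hb : ‖f - hpL.toLp‖ ≤ c * (ε / (c + 1)) := by
      refine Lp.norm_le_of_ae_bound hδ.le ?_
      have hfg : (f : ℝ × ℝ → ℝ) =ᵐ[μ] g := by
        rw [← hg]
        exact ContinuousMap.coeFn_toAEEqFun μ g.toContinuousMap
      filter_upwards [Lp.coeFn_sub f hpL.toLp, hpL.coeFn_toLp, hfg, hμ] with z h1 h2 h3 h4
      rw [h1, Pi.sub_apply, h2, h3, norm_sub_rev]
      have := hp z h4
      erw [hev] at this
      exact this.le
    refine hb.trans_lt ?_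
    rw [← mul_div_assoc, div_lt_iff₀ (by positivity)]
    nlinarith
  intro f _
  exact closure_minimal hsub M.isClosed_topologicalClosure (hd f)

/-! ### Products of a radial and a boundary polynomial in L² -/

/-- The function `g(s) p(x/s, y/s)` with `s = max {|x|,|y|}`. -/
def polarProd (g : Polynomial ℝ) (p : MvPolynomial (Fin 2) ℝ) (z : ℝ × ℝ) : ℝ :=
  g.eval (max |z.1| |z.2|) * evalPair p (z.1 / max |z.1| |z.2|, z.2 / max |z.1| |z.2|)

theorem squareQ_eq_polarProd (P : ℕ → ℕ → Polynomial ℝ)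
    (Y : (m : ℕ) → Fin (min (m + 1) 4) → MvPolynomial (Fin 2) ℝ) (a : SquareIndex) :
    squareQ P Y a = polarProd (P a.2.1 (a.1 - a.2.1) * Polynomial.X ^ (a.1 - (a.2.1 : ℕ)))
      (Y (a.1 - a.2.1) a.2.2) := by
  funext z
  simp [squareQ, polarProd, evalPair]

theorem measurable_polarProd (g : Polynomial ℝ) (p : MvPolynomial (Fin 2) ℝ) :
    Measurable (polarProd g p) :=
  (g.continuous.measurable.comp (by fun_prop)).mul
    ((continuous_evalPair p).measurable.comp (by fun_prop))

theorem polarProd_smul (g : Polynomial ℝ) (p : MvPolynomial (Fin 2) ℝ) {s : ℝ} (hs : 0 < s)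
    {z : ℝ × ℝ} (hz : max |z.1| |z.2| = 1) :
    polarProd g p (s • z) = g.eval s * evalPair p z := by
  rw [polarProd, max_abs_smul hs.le hz]
  simp [mul_div_cancel_left₀ _ hs.ne']

theorem ae_squareMeasure (w : ℝ → ℝ) :
    ∀ᵐ z ∂squareMeasure w, z ∈ Set.Icc (-1 : ℝ) 1 ×ˢ Set.Icc (-1 : ℝ) 1 :=
  (withDensity_absolutelyContinuous _ _).ae_le
    (ae_restrict_mem (measurableSet_Icc.prod measurableSet_Icc))

theorem ae_radialMeasure_prod (w : ℝ → ℝ) : ∀ᵐ z ∂(radialMeasure w).prod boundaryMeasure,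
    0 < z.1 ∧ max |z.2.1| |z.2.2| = 1 := by
  filter_upwards [Measure.quasiMeasurePreserving_fst.ae (ae_radialMeasure w),
    Measure.quasiMeasurePreserving_snd.ae ae_boundaryMeasure_max_abs] with z h1 h2
  exact ⟨h1.1, h2⟩

theorem IsRadialWeight.memLp_polarProd {w : ℝ → ℝ} (hw : IsRadialWeight w)
    (g : Polynomial ℝ) (p : MvPolynomial (Fin 2) ℝ) :
    MemLp (polarProd g p) 2 (squareMeasure w) := by
  have := hw.isFiniteMeasure_squareMeasure
  obtain ⟨C, hC⟩ := (isCompact_Icc (a := (-1 : ℝ)) (b := 1)).exists_bound_of_continuousOn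
    g.continuous.continuousOn
  obtain ⟨D, hD⟩ := ((isCompact_Icc (a := (-1 : ℝ)) (b := 1)).prod
    (isCompact_Icc (a := (-1 : ℝ)) (b := 1))).exists_bound_of_continuousOn
    (continuous_evalPair p).continuousOn
  refine MemLp.of_bound (measurable_polarProd g p).aestronglyMeasurable (C * D) ?_
  filter_upwards [ae_squareMeasure w] with z hz
  have hs : 0 ≤ max |z.1| |z.2| := (abs_nonneg _).trans (le_max_left _ _)
  -- This also holds at the origin, where the quotient is 0 by convention.
  have h1 : ∀ x, |x| ≤ max |z.1| |z.2| → x / max |z.1| |z.2| ∈ Set.Icc (-1 : ℝ) 1 := by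
    intro x hx
    rw [Set.mem_Icc, ← abs_le, abs_div, abs_of_nonneg hs]
    exact div_le_one_of_le₀ hx hs
  rw [polarProd, norm_mul]
  have hg := hC (max |z.1| |z.2|) ⟨by linarith, max_le (abs_le.2 hz.1) (abs_le.2 hz.2)⟩
  exact mul_le_mul hg (hD _ ⟨h1 _ (le_max_left _ _), h1 _ (le_max_right _ _)⟩) (norm_nonneg _)
    ((norm_nonneg _).trans hg)

theorem IsRadialWeight.integral_polarProd_mul {w : ℝ → ℝ} (hw : IsRadialWeight w)
    (g h : Polynomial ℝ)
    (p q : MvPolynomial (Fin 2) ℝ) :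
    ∫ z, polarProd g p z * polarProd h q z ∂squareMeasure w =
      (∫ s, g.eval s * h.eval s ∂radialMeasure w) * boundaryForm p q := by
  have := hw.isFiniteMeasure_radialMeasure
  have hm : Measurable fun z => polarProd g p z * polarProd h q z :=
    (measurable_polarProd g p).mul (measurable_polarProd h q)
  rw [hw.squareMeasure_eq_map, integral_map (by fun_prop) hm.aestronglyMeasurable,
    boundaryForm_eq_integral, ← integral_prod_mul]
  refine integral_congr_ae ?_
  filter_upwards [ae_radialMeasure_prod w] with z hz
  rw [polarProd_smul g p hz.1 hz.2, polarProd_smul h q hz.1 hz.2]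
  ring

/-- `polarProd` as a bilinear map to `L²`. -/
def IsRadialWeight.polarLp {w : ℝ → ℝ} (hw : IsRadialWeight w) :
    Polynomial ℝ →ₗ[ℝ] MvPolynomial (Fin 2) ℝ →ₗ[ℝ] Lp ℝ 2 (squareMeasure w) :=
  LinearMap.mk₂ ℝ (fun g p => (hw.memLp_polarProd g p).toLp)
    (fun g g' p => by
      rw [← MemLp.toLp_add]
      exact MemLp.toLp_congr _ _ (Filter.Eventually.of_forall fun z => by
        simp [polarProd, add_mul]))
    (fun c g p => by
      rw [← MemLp.toLp_const_smul]
      exact MemLp.toLp_congr _ _ (Filter.Eventually.of_forall fun z => by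
        simp [polarProd, mul_assoc]))
    (fun g p p' => by
      rw [← MemLp.toLp_add]
      exact MemLp.toLp_congr _ _ (Filter.Eventually.of_forall fun z => by
        simp [polarProd, mul_add]))
    (fun c g p => by
      rw [← MemLp.toLp_const_smul]
      exact MemLp.toLp_congr _ _ (Filter.Eventually.of_forall fun z => by
        simp [polarProd, mul_left_comm]))

theorem IsRadialWeight.polarLp_apply {w : ℝ → ℝ} (hw : IsRadialWeight w)
    (g : Polynomial ℝ) (p : MvPolynomial (Fin 2) ℝ) :
    hw.polarLp g p = (hw.memLp_polarProd g p).toLp := rfl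

theorem IsRadialWeight.inner_polarLp {w : ℝ → ℝ} (hw : IsRadialWeight w)
    (g h : Polynomial ℝ) (p q : MvPolynomial (Fin 2) ℝ) :
    inner ℝ (hw.polarLp g p) (hw.polarLp h q) =
      (∫ s, g.eval s * h.eval s ∂radialMeasure w) * boundaryForm p q := by
  rw [← hw.integral_polarProd_mul, L2.inner_def]
  refine integral_congr_ae ?_
  rw [hw.polarLp_apply, hw.polarLp_apply]
  filter_upwards [(hw.memLp_polarProd g p).coeFn_toLp, (hw.memLp_polarProd h q).coeFn_toLp]
    with z h1 h2
  rw [h1, h2]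
  simp [mul_comm]

/-- Only boundary values of p enter, so representatives modulo the ideal may be exchanged. -/
theorem IsRadialWeight.polarLp_congr {w : ℝ → ℝ} (hw : IsRadialWeight w)
    (g : Polynomial ℝ) {p q : MvPolynomial (Fin 2) ℝ}
    (h : modBoundary p = modBoundary q) : hw.polarLp g p = hw.polarLp g q := by
  rw [hw.polarLp_apply, hw.polarLp_apply]
  refine MemLp.toLp_congr _ _ ?_
  rw [hw.squareMeasure_eq_map]
  refine (ae_map_iff (by fun_prop) (measurableSet_eq_fun (measurable_polarProd g p)
    (measurable_polarProd g q))).2 ?_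
  filter_upwards [ae_radialMeasure_prod w] with z hz
  rw [polarProd_smul g p hz.1 hz.2, polarProd_smul g q hz.1 hz.2, evalPair_congr h hz.2]

/-- The finitely many roots of g are null for a measure with a density, and the radial measure is
not zero. -/
theorem IsRadialWeight.integral_sq_ne_zero {w : ℝ → ℝ} (hw : IsRadialWeight w)
    {g : Polynomial ℝ} (hg : g ≠ 0) :
    ∫ s, g.eval s * g.eval s ∂radialMeasure w ≠ 0 := by
  have := hw.isFiniteMeasure_radialMeasure
  intro h
  have hi : Integrable (fun s => g.eval s * g.eval s) (radialMeasure w) := by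
    have hc : Continuous fun s => g.eval s * g.eval s := g.continuous.mul g.continuous
    obtain ⟨C, hC⟩ := (isCompact_Icc (a := (0 : ℝ)) (b := 1)).exists_bound_of_continuousOn
      hc.continuousOn
    exact Integrable.of_bound hc.aestronglyMeasurable C
      ((ae_radialMeasure w).mono fun s hs => hC s ⟨hs.1.le, hs.2⟩)
  rw [integral_eq_zero_iff_of_nonneg (fun s => mul_self_nonneg _) hi] at h
  have hroots : ∀ᵐ s ∂radialMeasure w, ¬ g.IsRoot s := by
    refine (withDensity_absolutelyContinuous _ _).ae_le (ae_restrict_of_ae ?_)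
    exact measure_eq_zero_iff_ae_notMem.1
      ((Polynomial.finite_setOfPred_isRoot hg).measure_zero volume)
  refine hw.radialMeasure_ne_zero (ae_eq_bot.1 (Filter.eventually_false_iff_eq_bot.1 ?_))
  filter_upwards [h, hroots] with s h1 h2 using h2 (mul_self_eq_zero.1 h1)

theorem IsRadialWeight.integral_radial_eq_zero {w : ℝ → ℝ} (hw : IsRadialWeight w)
    {P : ℕ → ℕ → Polynomial ℝ}
    (hP : ∀ k m, IsOrthogonalPolynomial (fun t => t ^ (2 * m + 1) * w t) k (P k m))
    {k l : ℕ} (h : k ≠ l) (m : ℕ) :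
    ∫ s, (P k m * Polynomial.X ^ m).eval s * (P l m * Polynomial.X ^ m).eval s
      ∂radialMeasure w = 0 := by
  rw [hw.integral_radialMeasure]
  rcases lt_or_gt_of_ne h with h | h
  · refine Eq.trans (intervalIntegral.integral_congr fun t _ => ?_)
      ((hP l m).2 (P k m) (by rw [(hP k m).1]; exact_mod_cast h))
    simp only [Polynomial.eval_mul, Polynomial.eval_pow, Polynomial.eval_X]
    ring
  · refine Eq.trans (intervalIntegral.integral_congr fun t _ => ?_)
      ((hP k m).2 (P l m) (by rw [(hP l m).1]; exact_mod_cast h))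
    simp only [Polynomial.eval_mul, Polynomial.eval_pow, Polynomial.eval_X]
    ring

/-! ### Completeness of the system -/

theorem span_range_eq_top_of_degree_eq {p : ℕ → Polynomial ℝ} (hp : ∀ k, (p k).degree = k) :
    Submodule.span ℝ (Set.range p) = ⊤ := by
  let S : Polynomial.Sequence ℝ := ⟨p, hp⟩
  exact S.span fun i => isUnit_iff_ne_zero.2 (Polynomial.leadingCoeff_ne_zero.2 (S.ne_zero i))

/-- Reindexes by (k, m) with n = k + m. The cast is needed because `k + m - k` and `m` are equal
only propositionally. -/
theorem exists_squareIndex (P : ℕ → ℕ → Polynomial ℝ)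
    (Y : (m : ℕ) → Fin (min (m + 1) 4) → MvPolynomial (Fin 2) ℝ) (k m : ℕ)
    (i : Fin (min (m + 1) 4)) :
    ∃ a : SquareIndex, P a.2.1 (a.1 - a.2.1) * Polynomial.X ^ (a.1 - (a.2.1 : ℕ)) =
      P k m * Polynomial.X ^ m ∧ Y (a.1 - a.2.1) a.2.2 = Y m i := by
  have h : k + m - k = m := by omega
  refine ⟨⟨k + m, ⟨k, by omega⟩, Fin.cast (by simp only [h]) i⟩, by simp only [h], ?_⟩
  have key : ∀ (m' : ℕ) (h' : m' = m) (e : min (m + 1) 4 = min (m' + 1) 4),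
      Y m' (Fin.cast e i) = Y m i := by
    rintro _ rfl _; rfl
  exact key _ h (by rw [h])

/-- A monomial in polar form. -/
theorem evalPair_monomial_eq_polarProd (e : Fin 2 →₀ ℕ) (c : ℝ) {s : ℝ} (hs : 0 < s) {z : ℝ × ℝ}
    (hz : max |z.1| |z.2| = 1) :
    evalPair (MvPolynomial.monomial e c) (s • z) =
      polarProd (Polynomial.X ^ (e 0 + e 1)) (MvPolynomial.monomial e c) (s • z) := by
  rw [polarProd_smul _ _ hs hz]
  simp [evalPair, MvPolynomial.eval_monomial, Finsupp.prod_fintype, mul_pow, pow_add]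
  ring

theorem IsRadialWeight.polarLp_mem_span {w : ℝ → ℝ} (hw : IsRadialWeight w)
    {P : ℕ → ℕ → Polynomial ℝ} (hP : ∀ k m, (P k m).degree = k)
    (Y : (m : ℕ) → Fin (min (m + 1) 4) → MvPolynomial (Fin 2) ℝ)
    (hY : ∀ m, IsBoundaryOrthogonalBasis m (Y m)) {n : ℕ} {p : MvPolynomial (Fin 2) ℝ}
    (hp : p.totalDegree ≤ n) :
    hw.polarLp (Polynomial.X ^ n) p ∈ Submodule.span ℝ (Set.range fun a : SquareIndex =>
      hw.polarLp (P a.2.1 (a.1 - a.2.1) * Polynomial.X ^ (a.1 - (a.2.1 : ℕ)))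
        (Y (a.1 - a.2.1) a.2.2)) := by
  set M := Submodule.span ℝ (Set.range fun a : SquareIndex =>
      hw.polarLp (P a.2.1 (a.1 - a.2.1) * Polynomial.X ^ (a.1 - (a.2.1 : ℕ)))
        (Y (a.1 - a.2.1) a.2.2)) with hM
  -- For fixed m the P_{k,2m} span all polynomials, so any g may stand in for them.
  have hg : ∀ (g : Polynomial ℝ) m i, hw.polarLp (g * Polynomial.X ^ m) (Y m i) ∈ M := by
    intro g m i
    have h : g ∈ Submodule.span ℝ (Set.range fun k => P k m) := by
      rw [span_range_eq_top_of_degree_eq fun k => hP k m]; trivial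
    induction h using Submodule.span_induction with
    | mem g hg =>
      obtain ⟨k, rfl⟩ := hg
      obtain ⟨a, h1, h2⟩ := exists_squareIndex P Y k m i
      exact Submodule.subset_span ⟨a, by simp only [h1, h2]⟩
    | zero => simp
    | add g g' _ _ h h' =>
      rw [add_mul, map_add, LinearMap.add_apply]; exact add_mem h h'
    | smul c g _ h =>
      rw [smul_mul_assoc, map_smul, LinearMap.smul_apply]; exact M.smul_mem c h
  obtain ⟨p', hp', h⟩ := exists_mem_span_modBoundary_eq hY hp
  rw [← hw.polarLp_congr _ h]
  refine (Submodule.span_le.2 ?_ : _ ≤ M.comap (hw.polarLp (Polynomial.X ^ n))) hp'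
  rintro _ ⟨m, hm, i, rfl⟩
  -- The bound m ≤ n lets s^m be split off from s^n.
  have := hg (Polynomial.X ^ (n - m)) m i
  rwa [← pow_add, Nat.sub_add_cancel hm] at this

theorem IsRadialWeight.evalPair_mem_span {w : ℝ → ℝ} (hw : IsRadialWeight w)
    {M : Submodule ℝ (Lp ℝ 2 (squareMeasure w))}
    (hM : ∀ (n : ℕ) (p : MvPolynomial (Fin 2) ℝ), p.totalDegree ≤ n →
      hw.polarLp (Polynomial.X ^ n) p ∈ M)
    (p : MvPolynomial (Fin 2) ℝ) (hp : MemLp (evalPair p) 2 (squareMeasure w)) :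
    hp.toLp ∈ M := by
  have hmon : ∀ e c, ∃ f ∈ M, f =ᵐ[squareMeasure w] evalPair (MvPolynomial.monomial e c) := by
    intro e c
    refine ⟨_, hM (e 0 + e 1) (MvPolynomial.monomial e c) ?_, ?_⟩
    · refine (MvPolynomial.totalDegree_monomial_le e c).trans ?_
      simp [Finsupp.sum_fintype]
    · rw [hw.polarLp_apply]
      refine (MemLp.coeFn_toLp _).trans ?_
      rw [hw.squareMeasure_eq_map]
      refine (ae_map_iff (by fun_prop) (measurableSet_eq_fun (measurable_polarProd _ _)
        (continuous_evalPair _).measurable)).2 ?_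
      filter_upwards [ae_radialMeasure_prod w] with z hz
      exact (evalPair_monomial_eq_polarProd e c hz.1 hz.2).symm
  have hall : ∃ f ∈ M, f =ᵐ[squareMeasure w] evalPair p := by
    clear hp
    induction p using MvPolynomial.induction_on' with
    | monomial e c => exact hmon e c
    | add p q hp hq =>
      obtain ⟨f, hf, hfp⟩ := hp
      obtain ⟨g, hg, hgq⟩ := hq
      refine ⟨f + g, add_mem hf hg, ?_⟩
      filter_upwards [Lp.coeFn_add f g, hfp, hgq] with z h1 h2 h3
      rw [h1, Pi.add_apply, h2, h3, evalPair_add]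
  obtain ⟨f, hf, hfp⟩ := hall
  rwa [Lp.ext (hp.coeFn_toLp.trans hfp.symm)]

end

/-! ### Assembly of the theorem -/

theorem theorem4p1 (w : ℝ → ℝ) (hw : IsRadialWeight w)
    (P : ℕ → ℕ → Polynomial ℝ)
    (hP : ∀ k m, IsOrthogonalPolynomial (fun t => t ^ (2 * m + 1) * w t) k (P k m))
    (hP0 : ∀ m, P 0 m = 1)
    (Y : (m : ℕ) → Fin (min (m + 1) 4) → MvPolynomial (Fin 2) ℝ)
    (hY : ∀ m, IsBoundaryOrthogonalBasis m (Y m)) :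
    ∃ hQ : ∀ a : SquareIndex, MemLp (squareQ P Y a) 2 (squareMeasure w),
      IsCompleteOrthogonalBasis fun a : SquareIndex => (hQ a).toLp (squareQ P Y a) := by
  have := hw.isFiniteMeasure_squareMeasure
  refine ⟨fun a => by rw [squareQ_eq_polarProd]; exact hw.memLp_polarProd _ _, ?_⟩
  have hLp : (fun a : SquareIndex => MemLp.toLp (squareQ P Y a)
        (by rw [squareQ_eq_polarProd]; exact hw.memLp_polarProd _ _ :
          MemLp (squareQ P Y a) 2 (squareMeasure w))) = fun a : SquareIndex =>
      hw.polarLp (P a.2.1 (a.1 - a.2.1) * Polynomial.X ^ (a.1 - (a.2.1 : ℕ)))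
        (Y (a.1 - a.2.1) a.2.2) := by
    funext a
    simp only [hw.polarLp_apply, squareQ_eq_polarProd]
  rw [hLp]
  refine ⟨fun a h => ?_, fun a b hab => ?_, ?_⟩
  · have h2 := hw.inner_polarLp (P a.2.1 (a.1 - a.2.1) * Polynomial.X ^ (a.1 - (a.2.1 : ℕ)))
      (P a.2.1 (a.1 - a.2.1) * Polynomial.X ^ (a.1 - (a.2.1 : ℕ)))
      (Y (a.1 - a.2.1) a.2.2) (Y (a.1 - a.2.1) a.2.2)
    have hP1 : P a.2.1 (a.1 - a.2.1) ≠ 0 := by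
      rw [← Polynomial.degree_ne_bot, (hP _ _).1]; exact WithBot.natCast_ne_bot _
    rw [h, inner_zero_left] at h2
    exact mul_ne_zero (hw.integral_sq_ne_zero (mul_ne_zero hP1 (pow_ne_zero _ Polynomial.X_ne_zero)))
      ((hY _).boundaryForm_self_ne_zero _) h2.symm
  · rw [hw.inner_polarLp]
    obtain ⟨n, k, i⟩ := a
    obtain ⟨n', k', i'⟩ := b
    by_cases hm : n - (k : ℕ) = n' - (k' : ℕ)
    · by_cases hk : (k : ℕ) = k'
      -- Truncated subtraction does no harm, since k ≤ n and k' ≤ n'.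
      · have hn : n = n' := by omega
        subst hn
        obtain rfl := Fin.ext hk
        refine mul_eq_zero_of_right _ ((hY _).orthogonal _ _ fun hi => hab ?_)
        simp only at hi
        rw [hi]
      · refine mul_eq_zero_of_left ?_ _
        simp only [hm]
        exact hw.integral_radial_eq_zero hP hk _
    · exact mul_eq_zero_of_right _ (boundaryForm_eq_zero_of_ne hm ((hY _).mem_boundaryBV _)
        ((hY _).mem_boundaryBV _))
  · exact topologicalClosure_eq_top_of_evalPair_mem (isCompact_Icc.prod isCompact_Icc)
      (ae_squareMeasure w) _ (hw.evalPair_mem_span fun n p hp =>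
        hw.polarLp_mem_span (fun k m => (hP k m).1) Y hY hp)
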